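/- Let $N\ge 2$ be an integer and let $G$ be a finite simple graph with a weight function $\omega:E(G)\to\mathbb R$. For such a graph, $\tau(G)=\sum_T\prod_{e\in E(T)}\omega(e)$, the sum being over all spanning trees $T$ of $G$. For a weighted digraph $D$ with a vertex $u$, $\tau(D,u)=\sum_T\prod_{a\in T}\omega(a)$, the sum being over all directed spanning trees $T$ of $D$ with root $u$, i.e. connected spanning subdigraphs in which $u$ has out-degree $0$ and every other vertex has out-degree $1$. Parallel edges (or arcs from $a$ to $b$) are replaced by a single one carrying the sum of their weights. Suppose that $G$ is $(1,N)$-periodic: $G$ has an automorphism $\sigma$ of order $N$, preserving adjacency and weights, such that $V(G)$ is the disjoint union of $V_1=\{v:\sigma(v)=v\}$ and $V_2=\{v:\sigma^i(v)\ne v\text{ for all }1\le i<N\}$. Suppose moreover that $V_1=\emptyset$. Let $H_0$ be an induced subgraph of $G$ with vertices $v_1^{(0)},\dots,v_m^{(0)}$ such that the sets $\sigma^i(V(H_0))$, $0\le i<N$, form a partition of $V(G)$; put $v_x^{(i)}=\sigma^i(v_x^{(0)})$ and $\theta=e^{2\pi\sqrt{-1}/N}$. Let $H_0'$ be the weighted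 graph obtained from $H_0$ as follows: for each edge $e=v_x^{(0)}v_y^{(i)}$ of $G$ with $1\le i\le\lfloor N/2\rfloor$ and $x\ne y$, add an edge $v_x^{(0)}v_y^{(0)}$, of weight $\omega(e)$ if $i\ne N/2$ and of weight $\omega(e)/2$ if $i=N/2$. For $1\le j\le N-1$ let $D_j'$ be the weighted digraph obtained from $H_0$ as follows. 1. Replace each edge $e=v_x^{(0)}v_y^{(0)}$ of $H_0$ by the two arcs $(v_x^{(0)},v_y^{(0)})$ and $(v_y^{(0)},v_x^{(0)})$, each of weight $\omega(e)$. 2. Add a new vertex $u$. 3. For each edge $e=v_x^{(0)}v_y^{(i)}$ of $G$ with $1\le i\le\lfloor N/2\rfloor$ and $x\ne y$: if $i\ne N/2$, add the arcs $(v_x^{(0)},u)$, $(v_y^{(0)},u)$, $(v_x^{(0)},v_y^{(0)})$, $(v_y^{(0)},v_x^{(0)})$ of weights $(1-\theta^{ij})\omega(e)$, $(1-\theta^{-ij})\omega(e)$, $\theta^{ij}\omega(e)$, $\theta^{-ij}\omega(e)$ respectively; if $i=N/2$, add the arcs $(v_x^{(0)},u)$, $(v_x^{(0)},v_y^{(0)})$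 of weights $(1-\theta^{Nj/2})\omega(e)$, $\theta^{Nj/2}\omega(e)$ respectively. 4. For each edge $e=v_x^{(0)}v_x^{(i)}$ of $G$ with $1\le i\le\lfloor N/2\rfloor$, add an arc $(v_x^{(0)},u)$, of weight $(2-\theta^{ij}-\theta^{-ij})\omega(e)$ if $i\ne N/2$ and of weight $(1-\theta^{Nj/2})\omega(e)$ if $i=N/2$. Then $$\tau(G)=\frac{\tau(H_0')}{N}\prod_{t=1}^{N-1}\tau(D_t',u).$$ -/

import Mathlib

/-- A weighted simple graph: a simple graph together with a weight for every edge, the weight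
being extended by `0` to the pairs of vertices that are not edges. -/
structure WeightedGraph (V R : Type*) [Zero R] where
  graph : SimpleGraph V
  weight : Sym2 V → R
  weight_eq_zero : ∀ e, e ∉ graph.edgeSet → weight e = 0

/-- A weighted digraph: a digraph together with a weight for every arc, the weight being extended
by `0` to the ordered pairs of vertices that are not arcs. -/
structure WeightedDigraph (V R : Type*) [Zero R] where
  digraph : Digraph V
  weight : V → V → R
  weight_eq_zero : ∀ a b, ¬ digraph.Adj a b → weight a b = 0

namespace WeightedGraph

open Classical in
/-- `τ(G)`: the sum over all spanning trees of `G`, each given by its edge set `F`, of the product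
of the weights of its edges. -/
noncomputable def tau {V R : Type*} [Fintype V] [CommSemiring R] (G : WeightedGraph V R) : R :=
  ∑ F ∈ G.graph.edgeFinset.powerset with (SimpleGraph.fromEdgeSet (F : Set (Sym2 V))).IsTree,
    ∏ e ∈ F, G.weight e

/-- The subgraph of `G` induced by a set of vertices, with the weights of `G`. -/
def induce {V R : Type*} [Zero R] (G : WeightedGraph V R) (s : Finset V) :
    WeightedGraph s R where
  graph := G.graph.comap Subtype.val
  weight e := G.weight (e.map Subtype.val)
  weight_eq_zero e he := by
    apply G.weight_eq_zero
    induction e using Sym2.ind with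
    | _ a b => simpa using he

open Classical in
/-- The weighted simple graph that results from drawing a finite family of weighted edges and
replacing parallel edges by a single one that carries the sum of their weights. (Loops, which do
not occur below, are discarded.) -/
noncomputable def ofEdges {V R : Type*} [AddCommMonoid R] (E : Multiset (Sym2 V × R)) :
    WeightedGraph V R where
  graph := SimpleGraph.fromEdgeSet {e | ∃ w, (e, w) ∈ E}
  weight e := if e.IsDiag then 0 else ((E.filter fun p => p.1 = e).map Prod.snd).sum
  weight_eq_zero e he := by
    split_ifs with hd
    · rfl
    · have h : (E.filter fun p => p.1 = e) = 0 := by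
        rw [Multiset.filter_eq_nil]
        rintro ⟨e', w⟩ hp rfl
        exact he (by simpa [SimpleGraph.edgeSet_fromEdgeSet] using ⟨⟨w, hp⟩, hd⟩)
      simp [h]

open Classical in
/-- The edges of `G`, each with its weight. -/
noncomputable def edgeList {V R : Type*} [Fintype V] [Zero R] (G : WeightedGraph V R) :
    Multiset (Sym2 V × R) :=
  G.graph.edgeFinset.val.map fun e => (e, G.weight e)

/-- `σ` is an automorphism of the weighted graph `G`. -/
def IsAut {V R : Type*} [Zero R] (G : WeightedGraph V R) (σ : Equiv.Perm V) : Prop :=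
  (∀ u v, G.graph.Adj (σ u) (σ v) ↔ G.graph.Adj u v) ∧
    ∀ u v, G.weight s(σ u, σ v) = G.weight s(u, v)

end WeightedGraph

namespace WeightedDigraph

open Classical in
/-- `τ(D, r)`: the sum over all directed spanning trees of `D` with root `r`, each given by its
arc set `F`, of the product of the weights of its arcs. A directed spanning tree with root `r` is a
connected spanning subdigraph in which `r` has out-degree `0` and every other vertex has
out-degree `1`. -/
noncomputable def tau {V R : Type*} [Fintype V] [CommSemiring R] (D : WeightedDigraph V R)
    (r : V) : R :=
  ∑ F : Finset (V × V) with
      (∀ p ∈ F, D.digraph.Adj p.1 p.2) ∧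
      (SimpleGraph.fromRel fun a b => (a, b) ∈ F).Connected ∧
      (∀ b, (r, b) ∉ F) ∧
      (∀ a, a ≠ r → ∃! b, (a, b) ∈ F),
    ∏ p ∈ F, D.weight p.1 p.2

open Classical in
/-- The weighted digraph that results from drawing a finite family of weighted arcs
`(initial vertex, terminal vertex, weight)` and replacing multiple arcs from `a` to `b` by a single
one that carries the sum of their weights. -/
noncomputable def ofArcs {V R : Type*} [AddCommMonoid R] (A : Multiset (V × V × R)) :
    WeightedDigraph V R where
  digraph := { Adj := fun a b => ∃ w, (a, b, w) ∈ A }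
  weight a b := ((A.filter fun p => p.1 = a ∧ p.2.1 = b).map fun p => p.2.2).sum
  weight_eq_zero a b hab := by
    have h : (A.filter fun p => p.1 = a ∧ p.2.1 = b) = 0 := by
      rw [Multiset.filter_eq_nil]
      rintro ⟨a', b', w⟩ hp ⟨rfl, rfl⟩
      exact hab ⟨w, hp⟩
    simp [h]

end WeightedDigraph

namespace OnePeriodic

/-- `V₁`: the vertices fixed by `σ`. -/
def V₁ {V : Type*} (σ : Equiv.Perm V) : Set V := {v | σ v = v}

/-- `V₂`: the vertices not fixed by any of `σ, σ², …, σ^(N-1)`. -/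
def V₂ {V : Type*} (N : ℕ) (σ : Equiv.Perm V) : Set V :=
  {v | ∀ i : ℕ, 1 ≤ i → i < N → (σ ^ i) v ≠ v}

/-- `G` is `(1, N)`-periodic with respect to its automorphism `σ` of order `N`: the vertex set is
the disjoint union of `V₁` and `V₂`. -/
structure IsPeriodic {V R : Type*} [Zero R] (G : WeightedGraph V R) (N : ℕ)
    (σ : Equiv.Perm V) : Prop where
  isAut : G.IsAut σ
  order : orderOf σ = N
  disjoint : Disjoint (V₁ σ) (V₂ N σ)
  cover : V₁ σ ∪ V₂ N σ = Set.univ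

/-- `H₀` is the vertex set of a first part of the division of `G - S`, where `S` is the subgraph
induced by `V₁`, into `N` isomorphic parts: the sets `Hᵢ = σ^i(H₀)`, `0 ≤ i < N`, are pairwise
disjoint and their union is `V \ V₁`. -/
def IsFirstPart {V : Type*} (N : ℕ) (σ : Equiv.Perm V) (H₀ : Finset V) : Prop :=
  ∀ v, (v ∉ V₁ σ → ∃! i : Fin N, ∃ x ∈ H₀, (σ ^ (i : ℕ)) x = v) ∧
    (v ∈ V₁ σ → v ∉ H₀)

/-- `θ`, the primitive `N`-th root of unity `exp(2πi/N)`. -/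
noncomputable def theta (N : ℕ) : ℂ := Complex.exp (2 * Real.pi * Complex.I / N)

section Construction

variable {V : Type*} (G : WeightedGraph V ℝ) (N : ℕ) (σ : Equiv.Perm V) (H₀ : Finset V)

/-- `ω(v_x^(0) v_y^(i))`, where the vertices of `H₀` are denoted by `v_x^(0)` and
`v_y^(i) = σ^i(v_y^(0))`. -/
def crossWeight (i : ℕ) (x y : H₀) : ℝ := G.weight s((x : V), (σ ^ i) (y : V))

open Classical in
/-- The edges added to `H₀` to form `H₀'`: for each edge `e = v_x^(0) v_y^(i)` of `G` with
`1 ≤ i ≤ ⌊N/2⌋` and `x ≠ y`, an edge `v_x^(0) v_y^(0)`, of weight `ω(e)` if `i ≠ N/2` and of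
weight `ω(e)/2` if `i = N/2`. -/
noncomputable def addedEdges : Multiset (Sym2 H₀ × ℝ) :=
  ∑ i ∈ Finset.Icc 1 (N / 2), ∑ x : H₀, ∑ y : H₀,
    if x ≠ y ∧ G.graph.Adj (x : V) ((σ ^ i) (y : V)) then
      if 2 * i ≠ N then {(s(x, y), crossWeight G σ H₀ i x y)}
      else {(s(x, y), crossWeight G σ H₀ i x y / 2)}
    else 0

/-- The weighted graph `H₀'`. -/
noncomputable def H₀' : WeightedGraph H₀ ℝ :=
  WeightedGraph.ofEdges ((G.induce H₀).edgeList + addedEdges G N σ H₀)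

/-! The digraphs `Dⱼ'`. Their vertices are those of `H₀`, written `some x`, and the new vertex
`u`, written `none`. -/

open Classical in
/-- Step (1): each edge `v_x^(0) v_y^(0)` of `H₀` is replaced by two opposite arcs of the same
weight (one for each order of its ends). -/
noncomputable def arcs₁ : Multiset (Option H₀ × Option H₀ × ℂ) :=
  ∑ x : H₀, ∑ y : H₀,
    if (G.induce H₀).graph.Adj x y then {(some x, some y, ((G.induce H₀).weight s(x, y) : ℂ))}
    else 0

open Classical in
/-- Step (3): the arcs added for each edge `e = v_x^(0) v_y^(i)` of `G` with `1 ≤ i ≤ ⌊N/2⌋` and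
`x ≠ y`. -/
noncomputable def arcs₃ (j : ℕ) : Multiset (Option H₀ × Option H₀ × ℂ) :=
  ∑ i ∈ Finset.Icc 1 (N / 2), ∑ x : H₀, ∑ y : H₀,
    if x ≠ y ∧ G.graph.Adj (x : V) ((σ ^ i) (y : V)) then
      if 2 * i ≠ N then
        {(some x, none, (1 - theta N ^ (i * j)) * (crossWeight G σ H₀ i x y : ℂ)),
          (some y, none, (1 - (theta N ^ (i * j))⁻¹) * (crossWeight G σ H₀ i x y : ℂ)),
          (some x, some y, theta N ^ (i * j) * (crossWeight G σ H₀ i x y : ℂ)),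
          (some y, some x, (theta N ^ (i * j))⁻¹ * (crossWeight G σ H₀ i x y : ℂ))}
      else
        {(some x, none, (1 - theta N ^ (i * j)) * (crossWeight G σ H₀ i x y : ℂ)),
          (some x, some y, theta N ^ (i * j) * (crossWeight G σ H₀ i x y : ℂ))}
    else 0

open Classical in
/-- Step (4): the arc added for each edge `e = v_x^(0) v_x^(i)` of `G` with `1 ≤ i ≤ ⌊N/2⌋`. -/
noncomputable def arcs₄ (j : ℕ) : Multiset (Option H₀ × Option H₀ × ℂ) :=
  ∑ i ∈ Finset.Icc 1 (N / 2), ∑ x : H₀,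
    if G.graph.Adj (x : V) ((σ ^ i) (x : V)) then
      if 2 * i ≠ N then
        {(some x, none,
          (2 - theta N ^ (i * j) - (theta N ^ (i * j))⁻¹) * (crossWeight G σ H₀ i x x : ℂ))}
      else
        {(some x, none, (1 - theta N ^ (i * j)) * (crossWeight G σ H₀ i x x : ℂ))}
    else 0

/-- The weighted digraph `Dⱼ'`, obtained by the steps (1)-(4). -/
noncomputable def D' (j : ℕ) : WeightedDigraph (Option H₀) ℂ :=
  WeightedDigraph.ofArcs (arcs₁ G H₀ + arcs₃ G N σ H₀ j + arcs₄ G N σ H₀ j)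

end Construction

end OnePeriodic

open Finset


/-- A self-map of the vertex set that fixes the root `r` and along which every vertex eventually
reaches `r`. Such maps encode the spanning trees rooted at `r`. -/
def IsRootedMap {V : Type*} (r : V) (f : V → V) : Prop :=
  f r = r ∧ ∀ x, ∃ k : ℕ, f^[k] x = r

namespace IsRootedMap

variable {V : Type*} {r : V} {f : V → V}

theorem induction (hf : IsRootedMap r f) {P : V → Prop} (hr : P r)
    (step : ∀ x, x ≠ r → P (f x) → P x) (x : V) : P x := by
  obtain ⟨k, hk⟩ := hf.2 x
  induction k generalizing x with
  | zero => simp only [Function.iterate_zero, id_eq] at hk; rwa [hk]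
  | succ k ih =>
    by_cases hx : x = r
    · rwa [hx]
    · exact step x hx (ih (f x) (by simpa using hk))

theorem of_induction (hr : f r = r) {d : V → ℕ} (hd : ∀ x, x ≠ r → d (f x) < d x) :
    IsRootedMap r f := by
  refine ⟨hr, fun x => ?_⟩
  induction h : d x using Nat.strong_induction_on generalizing x with
  | _ n ih =>
    by_cases hx : x = r
    · exact ⟨0, hx⟩
    · obtain ⟨k, hk⟩ := ih (d (f x)) (h ▸ hd x hx) (f x) rfl
      exact ⟨k + 1, by simpa using hk⟩

theorem apply_ne_self (hf : IsRootedMap r f) {x : V} (hx : x ≠ r) : f x ≠ x := by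
  revert hx
  refine hf.induction (P := fun x => x ≠ r → f x ≠ x) (fun h => absurd rfl h) ?_ x
  intro x hx ih _ h
  rw [h] at ih
  exact ih hx h

theorem apply_apply_ne_self (hf : IsRootedMap r f) {x : V} (hx : x ≠ r) : f (f x) ≠ x := by
  revert hx
  refine hf.induction (P := fun x => x ≠ r → f (f x) ≠ x) (fun h => absurd rfl h) ?_ x
  intro x hx ih _ h
  rw [h] at ih
  refine ih ?_ rfl
  intro h'
  rw [h', hf.1] at h
  exact hx h.symm

/-- The number of steps to the root. -/
theorem exists_depth (hf : IsRootedMap r f) :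
    ∃ d : V → ℕ, ∀ x, x ≠ r → d (f x) < d x := by
  classical
  refine ⟨fun x => Nat.find (hf.2 x), fun x hx => ?_⟩
  have h := Nat.find_spec (hf.2 x)
  rcases hn : Nat.find (hf.2 x) with _ | k
  · rw [hn] at h
    exact absurd h hx
  · rw [hn] at h
    exact (Nat.lt_succ_of_le (Nat.find_min' (hf.2 (f x)) h)).trans_eq hn.symm

theorem sym2_injOn (hf : IsRootedMap r f) {x y : V} (hx : x ≠ r)
    (h : s(x, f x) = s(y, f y)) : x = y := by
  rcases Sym2.eq_iff.1 h with h | h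
  · exact h.1
  · refine absurd ?_ (hf.apply_apply_ne_self hx)
    rw [h.2, ← h.1]

end IsRootedMap

section Determinant

variable {V R : Type*} [Fintype V] [DecidableEq V] [CommRing R]

open Classical in
/-- The sum over all rooted maps of the product of the weights of the arcs `(x, f x)`, `x ≠ r`. -/
noncomputable def rootedSum {V R : Type*} [Fintype V] [DecidableEq V] [CommSemiring R] (w : V → V → R)
    (r : V) : R :=
  ∑ f : V → V with IsRootedMap r f, ∏ x ∈ univ.erase r, w x (f x)

/-- The matrix `1 - P`, where `P` is the matrix of the map `f` with the arcs into `r` deleted. -/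
def oneSubMap (R : Type*) [CommRing R] (r : V) (f : V → V) : Matrix V V R :=
  Matrix.of fun x y => (Pi.single x 1 : V → R) y - if f x = r then 0 else (Pi.single (f x) 1 : V → R) y

theorem det_oneSubMap_of_isRootedMap {r : V} {f : V → V} (hf : IsRootedMap r f) :
    (oneSubMap R r f).det = 1 := by
  obtain ⟨d, hd⟩ := hf.exists_depth
  have key : ∀ x y, x ≠ y → d x ≤ d y → oneSubMap R r f x y = 0 := by
    intro x y hxy hle
    simp only [oneSubMap, Matrix.of_apply, Pi.single_apply, if_neg hxy.symm, zero_sub,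
      neg_eq_zero]
    split_ifs with h1 h2
    · rfl
    · have hx : x ≠ r := by
        rintro rfl
        exact h1 hf.1
      exact absurd (hd x hx) (by rw [← h2]; omega)
    · rfl
  have hdiag : ∀ x, oneSubMap R r f x x = 1 := by
    intro x
    simp only [oneSubMap, Matrix.of_apply, Pi.single_apply, if_true, sub_eq_self]
    split_ifs with h1 h2
    · rfl
    · have hx : x ≠ r := by
        rintro rfl
        exact h1 hf.1
      exact absurd h2.symm (hf.apply_ne_self hx)
    · rfl
  rw [Matrix.BlockTriangular.det (b := fun x => OrderDual.toDual (d x))]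
  · refine Finset.prod_eq_one fun a _ => ?_
    rw [← Matrix.det_one (n := {x // OrderDual.toDual (d x) = a})]
    congr 1
    ext x y
    obtain ⟨x, hx⟩ := x
    obtain ⟨y, hy⟩ := y
    simp only [Matrix.toSquareBlock_def, Matrix.of_apply, Matrix.one_apply, Subtype.mk.injEq]
    split_ifs with h
    · rw [h, hdiag]
    · exact key x y h (le_of_eq (OrderDual.toDual.injective (hx.trans hy.symm)))
  · intro x y hxy
    refine key x y ?_ (le_of_lt hxy)
    rintro rfl
    exact lt_irrefl _ hxy

theorem det_oneSubMap_of_not_isRootedMap [IsDomain R] {r : V} {f : V → V} (hr : f r = r)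
    (hf : ¬ IsRootedMap r f) : (oneSubMap R r f).det = 0 := by
  classical
  have hex : ∃ x, ∀ k : ℕ, f^[k] x ≠ r := by
    by_contra! h
    exact hf ⟨hr, h⟩
  obtain ⟨x₀, hx₀⟩ := hex
  have hstep : ∀ x, (∀ k : ℕ, f^[k] (f x) ≠ r) ↔ ∀ k : ℕ, f^[k] x ≠ r := by
    intro x
    constructor
    · rintro h (_ | k)
      · rintro h0
        simp only [Function.iterate_zero, id_eq] at h0
        exact h 0 (by simp [h0, hr])
      · simpa using h k
    · intro h k
      simpa using h (k + 1)
  rw [← Matrix.exists_mulVec_eq_zero_iff]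
  refine ⟨fun x => if ∀ k : ℕ, f^[k] x ≠ r then 1 else 0, ?_, ?_⟩
  · intro h
    have := congrFun h x₀
    simp [hx₀] at this
  · ext x
    simp only [Matrix.mulVec, dotProduct, oneSubMap, Matrix.of_apply, sub_mul,
      Finset.sum_sub_distrib, Pi.zero_apply]
    by_cases h : f x = r
    · have : ¬ ∀ k : ℕ, f^[k] x ≠ r := fun h' => h' 1 (by simpa using h)
      simp only [h, if_true, Pi.single_apply, ite_mul, one_mul, zero_mul, Finset.sum_ite_eq',
        Finset.mem_univ, Finset.sum_const_zero, sub_zero, if_neg this]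
    · simp only [if_neg h, Pi.single_apply, ite_mul, one_mul, zero_mul, Finset.sum_ite_eq',
        Finset.mem_univ, if_true, hstep, sub_self]

/-- The Laplacian matrix of the weighted digraph with arc weights `w`. -/
def lap (w : V → V → R) : Matrix V V R :=
  Matrix.diagonal (fun x => ∑ z, w x z) - Matrix.of w

/-- The Laplacian matrix in which the row and the column of the root are replaced by those of the
identity matrix. -/
def rootLap (w : V → V → R) (r : V) : Matrix V V R :=
  Matrix.of fun x y => if x = r ∨ y = r then (Pi.single x 1 : V → R) y else lap w x y

/-- The matrix-tree theorem for weighted digraphs. -/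
theorem det_rootLap [IsDomain R] (w : V → V → R) (r : V) :
    (rootLap w r).det = rootedSum w r := by
  classical
  have hrow : rootLap w r = Matrix.of fun x => ∑ z ∈ (if x = r then {r} else univ),
      (if x = r then 1 else w x z) • (fun y => (Pi.single x 1 : V → R) y -
        if z = r then 0 else (Pi.single z 1 : V → R) y) := by
    ext x y
    simp only [rootLap, Matrix.of_apply, Finset.sum_apply, Pi.smul_apply, smul_eq_mul]
    by_cases hx : x = r
    · subst hx
      simp
    · simp only [hx, false_or, if_false, mul_sub, Finset.sum_sub_distrib]
      by_cases hy : y = r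
      · subst hy
        have : ∀ z, (w x z * if z = y then 0 else (Pi.single z 1 : V → R) y) = 0 := by
          intro z
          split_ifs with h
          · simp
          · simp [Ne.symm h]
        rw [Finset.sum_congr rfl fun z _ => this z]
        simp [Ne.symm hx]
      · have : ∀ z, (w x z * if z = r then 0 else (Pi.single z 1 : V → R) y) =
            if y = z then w x z else 0 := by
          intro z
          by_cases h : z = r
          · subst h
            simp [hy]
          · simp [h, Pi.single_apply]
        rw [Finset.sum_congr rfl fun z _ => this z]
        simp only [hy, if_false, lap, Matrix.sub_apply, Matrix.diagonal_apply,
          Matrix.of_apply, Pi.single_apply, Finset.sum_ite_eq, Finset.mem_univ, if_true]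
        by_cases hxy : x = y
        · subst hxy
          simp
        · simp [hxy, Ne.symm hxy]
  rw [hrow]
  have := (Matrix.detRowAlternating (n := V) (R := R)).toMultilinearMap.map_sum_finset
    (fun x z => (if x = r then 1 else w x z) • (fun y => (Pi.single x 1 : V → R) y -
        if z = r then 0 else (Pi.single z 1 : V → R) y)) (fun x => if x = r then {r} else univ)
  refine this.trans ?_
  have hterm : ∀ f ∈ Fintype.piFinset (fun x : V => if x = r then {r} else univ),
      (Matrix.detRowAlternating (n := V) (R := R)).toMultilinearMap (fun x =>
        (if x = r then 1 else w x (f x)) • (fun y => (Pi.single x 1 : V → R) y -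
        if f x = r then 0 else (Pi.single (f x) 1 : V → R) y)) =
      if IsRootedMap r f then ∏ x ∈ univ.erase r, w x (f x) else 0 := by
    intro f hf
    rw [MultilinearMap.map_smul_univ]
    have hfr : f r = r := by
      have := Fintype.mem_piFinset.1 hf r
      simpa using this
    have hdet : (Matrix.detRowAlternating (n := V) (R := R)).toMultilinearMap (fun x =>
        (fun y => (Pi.single x 1 : V → R) y - if f x = r then 0 else (Pi.single (f x) 1 : V → R) y)) =
        (oneSubMap R r f).det := rfl
    have hprod : (∏ x, if x = r then 1 else w x (f x)) = ∏ x ∈ univ.erase r, w x (f x) := by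
      rw [← Finset.mul_prod_erase univ _ (Finset.mem_univ r), if_pos rfl, one_mul]
      exact Finset.prod_congr rfl fun x hx => if_neg (Finset.ne_of_mem_erase hx)
    rw [hprod]
    split_ifs with h
    · refine (congrArg _ (hdet.trans (det_oneSubMap_of_isRootedMap h))).trans ?_
      simp
    · refine (congrArg _ (hdet.trans (det_oneSubMap_of_not_isRootedMap hfr h))).trans ?_
      simp
  rw [Finset.sum_congr rfl hterm, rootedSum, Finset.sum_filter]
  refine Finset.sum_subset (f := fun f => if IsRootedMap r f then ∏ x ∈ univ.erase r, w x (f x)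
    else 0) (Finset.subset_univ _) fun f _ hf => if_neg fun h => hf ?_
  rw [Fintype.mem_piFinset]
  intro x
  split_ifs with hx
  · rw [hx, h.1]; simp
  · simp

end Determinant

theorem IsRootedMap.connected {V : Type*} {r : V} {f : V → V} (hf : IsRootedMap r f) {H : SimpleGraph V}
    (hH : ∀ x, x ≠ r → H.Adj x (f x)) : H.Connected := by
  have h : ∀ x, H.Reachable x r := hf.induction (P := fun x => H.Reachable x r)
    (SimpleGraph.Reachable.refl r) fun x hx ih => (hH x hx).reachable.trans ih
  have : Nonempty V := ⟨r⟩
  exact ⟨fun x y => (h x).trans (h y).symm⟩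

theorem isRootedMap_of_connected {V : Type*} {r : V} {f : V → V} (hr : f r = r) {H : SimpleGraph V}
    (hc : H.Connected) (hH : ∀ x y, H.Adj x y → (x ≠ r ∧ y = f x) ∨ (y ≠ r ∧ x = f y)) :
    IsRootedMap r f := by
  refine ⟨hr, fun x => ?_⟩
  have key : ∀ {y : V}, H.Walk x y → y = r → ∃ k : ℕ, f^[k] x = r := by
    intro y p hy
    induction p with
    | nil => exact ⟨0, hy⟩
    | cons hadj p ih =>
      obtain ⟨k, hk⟩ := ih hy
      rcases hH _ _ hadj with ⟨hx, rfl⟩ | ⟨hy, rfl⟩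
      · exact ⟨k + 1, by rwa [Function.iterate_succ_apply]⟩
      · rcases k with _ | k
        · exact absurd hk hy
        · exact ⟨k, by rwa [Function.iterate_succ_apply] at hk⟩
  obtain ⟨p⟩ := hc.preconnected x r
  exact key p rfl

section Trees

variable {V R : Type*} [Fintype V] [DecidableEq V] [CommSemiring R]

/-- Directed spanning trees with root `r` correspond to rooted maps. -/
theorem WeightedDigraph.tau_eq_rootedSum (D : WeightedDigraph V R) (r : V) :
    D.tau r = rootedSum D.weight r := by
  classical
  have hinj : ∀ f : V → V, Function.Injective fun x => (x, f x) := fun f x y h =>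
    (Prod.mk.inj h).1
  symm
  have hzero : rootedSum D.weight r = ∑ f : V → V with
      (∀ x, x ≠ r → D.digraph.Adj x (f x)) ∧ IsRootedMap r f,
        ∏ x ∈ univ.erase r, D.weight x (f x) := by
    rw [rootedSum]
    symm
    refine Finset.sum_subset ?_ ?_
    · intro f hf
      simp only [Finset.mem_filter, Finset.mem_univ, true_and] at hf ⊢
      exact hf.2
    · intro f hf hf'
      simp only [Finset.mem_filter, Finset.mem_univ, true_and] at hf hf'
      have : ∃ x, x ≠ r ∧ ¬ D.digraph.Adj x (f x) := by
        by_contra! h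
        exact hf' ⟨h, hf⟩
      obtain ⟨x, hx, hadj⟩ := this
      exact Finset.prod_eq_zero (Finset.mem_erase.2 ⟨hx, Finset.mem_univ x⟩)
        (D.weight_eq_zero _ _ hadj)
  rw [hzero, WeightedDigraph.tau]
  have hmem : ∀ (f : V → V) (a b : V), (a, b) ∈ (univ.erase r).image (fun x => (x, f x)) ↔
      a ≠ r ∧ b = f a := by
    intro f a b
    simp only [Finset.mem_image, Finset.mem_erase, Finset.mem_univ, and_true, Prod.mk.injEq]
    constructor
    · rintro ⟨x, hx, rfl, rfl⟩
      exact ⟨hx, rfl⟩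
    · rintro ⟨h, rfl⟩
      exact ⟨a, h, rfl, rfl⟩
  refine Finset.sum_nbij (fun f => (univ.erase r).image fun x => (x, f x)) ?_ ?_ ?_ ?_
  · intro f hf
    simp only [Finset.mem_filter, Finset.mem_univ, true_and] at hf ⊢
    obtain ⟨hadj, hf⟩ := hf
    refine ⟨?_, ?_, ?_, ?_⟩
    · rintro ⟨a, b⟩ hp
      obtain ⟨ha, rfl⟩ := (hmem f a b).1 hp
      exact hadj a ha
    · refine hf.connected fun x hx => ?_
      rw [SimpleGraph.fromRel_adj]
      exact ⟨(hf.apply_ne_self hx).symm, Or.inl ((hmem f _ _).2 ⟨hx, rfl⟩)⟩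
    · intro b hb
      exact ((hmem f _ _).1 hb).1 rfl
    · intro a ha
      exact ⟨f a, (hmem f _ _).2 ⟨ha, rfl⟩, fun b hb => ((hmem f _ _).1 hb).2⟩
  · intro f hf g hg hfg
    simp only [Finset.coe_filter, Finset.mem_univ, true_and, Set.mem_ofPred_eq] at hf hg
    funext x
    by_cases hx : x = r
    · rw [hx, hf.2.1, hg.2.1]
    · have := (hmem f x (f x)).2 ⟨hx, rfl⟩
      rw [show ((univ.erase r).image fun x => (x, f x)) = (univ.erase r).image fun x => (x, g x)
        from hfg] at this
      exact ((hmem g _ _).1 this).2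
  · intro F hF
    simp only [Finset.coe_filter, Finset.mem_univ, true_and, Set.mem_ofPred_eq] at hF
    obtain ⟨hadj, hc, hr, hex⟩ := hF
    choose! f hf hu using hex
    have hg : ∀ x, x ≠ r → Function.update f r r x = f x := fun x hx =>
      Function.update_of_ne hx _ _
    have hFmem : ∀ a b, (a, b) ∈ F ↔ a ≠ r ∧ b = Function.update f r r a := by
      intro a b
      constructor
      · intro h
        have ha : a ≠ r := by
          rintro rfl
          exact hr b h
        exact ⟨ha, by rw [hg a ha]; exact hu a ha b h⟩
      · rintro ⟨ha, rfl⟩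
        rw [hg a ha]
        exact hf a ha
    refine ⟨Function.update f r r, ?_, ?_⟩
    · simp only [Finset.coe_filter, Finset.mem_univ, true_and, Set.mem_ofPred_eq]
      refine ⟨fun x hx => ?_, isRootedMap_of_connected (Function.update_self ..) hc ?_⟩
      · exact hadj (x, _) ((hFmem _ _).2 ⟨hx, rfl⟩)
      · intro x y hxy
        rw [SimpleGraph.fromRel_adj] at hxy
        exact hxy.2.imp (fun h => (hFmem _ _).1 h) (fun h => (hFmem _ _).1 h)
    · ext ⟨a, b⟩
      exact (hmem _ a b).trans (hFmem a b).symm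
  · intro f hf
    rw [Finset.prod_image fun x _ y _ h => hinj f h]

/-- A connected graph has a rooted map along its edges. -/
theorem SimpleGraph.Connected.exists_isRootedMap {V : Type*} [DecidableEq V] {H : SimpleGraph V}
    (hc : H.Connected) (r : V) :
    ∃ f : V → V, IsRootedMap r f ∧ ∀ x, x ≠ r → H.Adj x (f x) := by
  have h : ∀ x, x ≠ r → ∃ y, H.Adj x y ∧ H.dist y r < H.dist x r := by
    intro x hx
    obtain ⟨p, hp⟩ := hc.exists_walk_length_eq_dist x r
    cases p with
    | nil => exact absurd rfl hx
    | cons hadj q =>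
      refine ⟨_, hadj, ?_⟩
      rw [← hp, SimpleGraph.Walk.length_cons]
      exact Nat.lt_succ_of_le (SimpleGraph.dist_le q)
  choose! f hadj hd using h
  refine ⟨Function.update f r r, IsRootedMap.of_induction (Function.update_self ..)
    (d := fun x => H.dist x r) fun x hx => ?_, fun x hx => ?_⟩
  · rw [Function.update_of_ne hx]
    exact hd x hx
  · rw [Function.update_of_ne hx]
    exact hadj x hx

/-- The sum defining `τ(G)`, indexed by finsets of edges. -/
theorem WeightedGraph.tau_eq_sum_finset {V R : Type*} [Fintype V] [CommSemiring R] (G : WeightedGraph V R)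
    [Fintype G.graph.edgeSet]
    [DecidablePred fun F : Finset (Sym2 V) => (SimpleGraph.fromEdgeSet (F : Set (Sym2 V))).IsTree] :
    G.tau = ∑ F ∈ G.graph.edgeFinset.powerset.filter fun F : Finset (Sym2 V) =>
      (SimpleGraph.fromEdgeSet (F : Set (Sym2 V))).IsTree, ∏ e ∈ F, G.weight e := by
  classical
  symm
  rw [WeightedGraph.tau]
  refine Finset.sum_nbij (fun F => (F : Set (Sym2 V))) ?_ ?_ ?_ ?_
  · intro F hF
    simp only [Finset.bind_def, Finset.pure_def, Finset.mem_filter, Finset.mem_sup, Finset.mem_singleton] at hF ⊢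
    refine ⟨⟨F, ?_, rfl⟩, hF.2⟩
    convert hF.1
  · exact fun F _ F' _ h => Finset.coe_injective h
  · intro S hS
    simp only [Finset.bind_def, Finset.pure_def, Finset.coe_filter, Finset.mem_sup, Finset.mem_singleton,
      Set.mem_ofPred_eq] at hS
    obtain ⟨⟨F, hF, rfl⟩, ht⟩ := hS
    refine ⟨F, ?_, rfl⟩
    simp only [Finset.coe_filter, Set.mem_ofPred_eq]
    refine ⟨?_, ht⟩
    convert hF
  · intro F hF
    simp

/-- Spanning trees correspond to rooted maps. -/
theorem WeightedGraph.tau_eq_rootedSum (G : WeightedGraph V R) (r : V) :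
    G.tau = rootedSum (fun x y => G.weight s(x, y)) r := by
  classical
  symm
  have hzero : rootedSum (fun x y => G.weight s(x, y)) r = ∑ f : V → V with
      (∀ x, x ≠ r → G.graph.Adj x (f x)) ∧ IsRootedMap r f,
        ∏ x ∈ univ.erase r, G.weight s(x, f x) := by
    rw [rootedSum]
    symm
    refine Finset.sum_subset ?_ ?_
    · intro f hf
      simp only [Finset.mem_filter, Finset.mem_univ, true_and] at hf ⊢
      exact hf.2
    · intro f hf hf'
      simp only [Finset.mem_filter, Finset.mem_univ, true_and] at hf hf'
      have : ∃ x, x ≠ r ∧ ¬ G.graph.Adj x (f x) := by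
        by_contra! h
        exact hf' ⟨h, hf⟩
      obtain ⟨x, hx, hadj⟩ := this
      exact Finset.prod_eq_zero (Finset.mem_erase.2 ⟨hx, Finset.mem_univ x⟩)
        (G.weight_eq_zero _ (by simpa using hadj))
  rw [hzero, WeightedGraph.tau_eq_sum_finset]
  have hinjOn : ∀ f : V → V, IsRootedMap r f →
      Set.InjOn (fun x => s(x, f x)) (univ.erase r : Finset V) := by
    intro f hf x hx y _ h
    exact hf.sym2_injOn (Finset.ne_of_mem_erase hx) h
  have hcard : ∀ f : V → V, IsRootedMap r f →
      ((univ.erase r).image fun x => s(x, f x)).card + 1 = Fintype.card V := by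
    intro f hf
    rw [Finset.card_image_of_injOn (hinjOn f hf), Finset.card_erase_add_one (Finset.mem_univ r),
      Finset.card_univ]
  have hedge : ∀ F : Finset (Sym2 V), (∀ e ∈ F, ¬ e.IsDiag) →
      (SimpleGraph.fromEdgeSet (F : Set (Sym2 V))).edgeSet = F := by
    intro F hF
    rw [SimpleGraph.edgeSet_fromEdgeSet]
    ext e
    simp only [Set.mem_sdiff, Finset.mem_coe]
    exact ⟨fun h => h.1, fun h => ⟨h, hF e h⟩⟩
  have hmem : ∀ (f : V → V) (x : V), x ≠ r → s(x, f x) ∈ (univ.erase r).image fun x => s(x, f x) :=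
    fun f x hx => Finset.mem_image_of_mem (fun x => s(x, f x))
      (Finset.mem_erase.2 ⟨hx, Finset.mem_univ x⟩)
  refine Finset.sum_nbij (fun f => (univ.erase r).image fun x => s(x, f x)) ?_ ?_ ?_ ?_
  · intro f hf
    simp only [Finset.mem_filter, Finset.mem_univ, true_and] at hf ⊢
    obtain ⟨hadj, hf⟩ := hf
    have hsub : ((univ.erase r).image fun x => s(x, f x)) ⊆ G.graph.edgeFinset := by
      intro e he
      obtain ⟨x, hx, rfl⟩ := Finset.mem_image.1 he
      rw [SimpleGraph.mem_edgeFinset]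
      exact hadj x (Finset.ne_of_mem_erase hx)
    refine ⟨Finset.mem_powerset.2 hsub, ?_⟩
    rw [SimpleGraph.isTree_iff_connected_and_card]
    refine ⟨hf.connected fun x hx => ?_, ?_⟩
    · rw [SimpleGraph.fromEdgeSet_adj]
      exact ⟨hmem f x hx, (hf.apply_ne_self hx).symm⟩
    · rw [hedge _ fun e he => G.graph.not_isDiag_of_mem_edgeSet
        (SimpleGraph.mem_edgeFinset.1 (hsub he))]
      rw [Nat.card_coe_set_eq, Set.ncard_coe_finset, Nat.card_eq_fintype_card, hcard f hf]
  · intro f hf g hg hfg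
    simp only [Finset.coe_filter, Finset.mem_univ, true_and, Set.mem_ofPred_eq] at hf hg
    have hfg : ((univ.erase r).image fun x => s(x, f x)) =
      (univ.erase r).image fun x => s(x, g x) := hfg
    funext x
    refine hf.2.induction (P := fun x => f x = g x) (hf.2.1.trans hg.2.1.symm) ?_ x
    intro x hx ih
    have := hmem f x hx
    rw [hfg] at this
    obtain ⟨y, hy, hxy⟩ := Finset.mem_image.1 this
    rcases Sym2.eq_iff.1 hxy with h | h
    · rw [← h.2, h.1]
    · refine absurd ?_ (hf.2.apply_apply_ne_self hx)
      rw [ih, ← h.1, h.2]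
  · intro F hF
    simp only [Finset.coe_filter, Finset.mem_powerset, Set.mem_ofPred_eq] at hF
    obtain ⟨hsub, htree⟩ := hF
    obtain ⟨f, hf, hadj⟩ := htree.1.exists_isRootedMap r
    have hadj' : ∀ x, x ≠ r → s(x, f x) ∈ F := fun x hx => by
      have := hadj x hx
      rw [SimpleGraph.fromEdgeSet_adj] at this
      exact this.1
    refine ⟨f, ?_, ?_⟩
    · simp only [Finset.coe_filter, Finset.mem_univ, true_and, Set.mem_ofPred_eq]
      refine ⟨fun x hx => ?_, hf⟩
      have := hsub (hadj' x hx)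
      rwa [SimpleGraph.mem_edgeFinset] at this
    · refine Finset.eq_of_subset_of_card_le ?_ ?_
      · intro e he
        obtain ⟨x, hx, rfl⟩ := Finset.mem_image.1 he
        exact hadj' x (Finset.ne_of_mem_erase hx)
      · have h1 := (SimpleGraph.isTree_iff_connected_and_card.1 htree).2
        rw [hedge F fun e he => G.graph.not_isDiag_of_mem_edgeSet
          (SimpleGraph.mem_edgeFinset.1 (hsub he)), Nat.card_coe_set_eq,
          Set.ncard_coe_finset, Nat.card_eq_fintype_card] at h1
        have h2 := hcard f hf
        exact Nat.le_of_add_le_add_right (h1.trans h2.symm).le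
  · intro f hf
    simp only [Finset.mem_filter, Finset.mem_univ, true_and] at hf
    rw [Finset.prod_image (hinjOn f hf.2)]

end Trees

section Laplacian

variable {V R : Type*} [Fintype V] [DecidableEq V] [CommRing R]

theorem sum_lap_row (w : V → V → R) (x : V) : ∑ y, lap w x y = 0 := by
  simp [lap, Matrix.diagonal_apply]

theorem lap_transpose {w : V → V → R} (hw : ∀ x y, w x y = w y x) : (lap w).transpose = lap w := by
  ext x y
  simp only [lap, Matrix.transpose_apply, Matrix.sub_apply, Matrix.of_apply, hw y x,
    Matrix.diagonal_apply]
  by_cases h : x = y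
  · subst h; rfl
  · simp [h, Ne.symm h]

theorem sum_lap_col {w : V → V → R} (hw : ∀ x y, w x y = w y x) (y : V) :
    ∑ x, lap w x y = 0 := by
  rw [← sum_lap_row w y]
  exact Finset.sum_congr rfl fun x _ => congrFun (congrFun (lap_transpose hw) y) x

theorem det_eq_of_forall_col_eq_add_mul {A B : Matrix V V R} (c : V → R) (k : V) (hk : c k = 0)
    (h : ∀ i j, A i j = B i j + c j * B i k) : A.det = B.det := by
  rw [← Matrix.det_transpose A, ← Matrix.det_transpose B]
  exact Matrix.det_eq_of_forall_row_eq_smul_add_const c k hk fun i j => h j i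

/-- The determinant of the Laplacian matrix of a weighted graph perturbed by a constant matrix. -/
theorem det_lap_add_const {w : V → V → R} (hw : ∀ x y, w x y = w y x) (r : V) (t : R) :
    (lap w + Matrix.of fun _ _ => t).det =
      t * (Fintype.card V : R) ^ 2 * (rootLap w r).det := by
  set n : R := (Fintype.card V : R) with hn
  set A : Matrix V V R := lap w + Matrix.of fun _ _ => t with hA
  have h1 : A.det = t * n * (A.updateRow r fun _ => 1).det := by
    have := Matrix.det_updateRow_sum A r (fun _ => 1)
    rw [one_smul] at this
    rw [← this, ← Matrix.det_updateRow_smul]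
    congr 2
    ext y
    simp only [one_smul, Pi.smul_apply, smul_eq_mul, mul_one]
    refine (Finset.sum_apply y univ _).trans ?_
    simp [hA, Matrix.add_apply, Finset.sum_add_distrib, sum_lap_col hw, hn, mul_comm t]
  have h2 : (A.updateRow r fun _ => 1).det = ((lap w).updateRow r fun _ => 1).det := by
    refine Matrix.det_eq_of_forall_row_eq_smul_add_const (fun x => if x = r then 0 else t) r
      (if_pos rfl) fun x y => ?_
    by_cases hx : x = r
    · subst hx; simp
    · simp [hx, hA]
  set B : Matrix V V R := (lap w).updateRow r fun _ => 1 with hB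
  have h3 : B.det = n * (B.updateCol r (Pi.single r 1)).det := by
    have := Matrix.det_updateCol_sum B r (fun _ => 1)
    rw [one_smul] at this
    rw [← this, ← Matrix.det_updateCol_smul]
    congr 2
    ext x
    by_cases hx : x = r
    · subst hx; simp [hB, hn]
    · simp [hB, hx, sum_lap_row]
  have h4 : (B.updateCol r (Pi.single r 1)).det = (rootLap w r).det := by
    refine det_eq_of_forall_col_eq_add_mul (fun y => if y = r then 0 else 1) r (if_pos rfl)
      fun x y => ?_
    by_cases hx : x = r
    · subst hx
      by_cases hy : y = x
      · subst hy; simp [rootLap]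
      · simp [rootLap, hB, hy]
    · by_cases hy : y = r
      · subst hy; simp [rootLap, Pi.single_apply, eq_comm]
      · simp [rootLap, hB, hx, hy]
  rw [h1, h2, h3, h4]
  ring

/-- The root `none` may be deleted from the reduced Laplacian matrix. -/
theorem det_rootLap_none {H : Type*} [Fintype H] [DecidableEq H] (w : Option H → Option H → R) :
    (rootLap w none).det =
      (lap (fun x y => w (some x) (some y)) + Matrix.diagonal fun x => w (some x) none).det := by
  rw [← Matrix.det_submatrix_equiv_self (Equiv.optionEquivSumPUnit.{0} H).symm,
    ← Matrix.fromBlocks_toBlocks ((rootLap w none).submatrix _ _)]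
  have h12 : ((rootLap w none).submatrix (Equiv.optionEquivSumPUnit.{0} H).symm
      (Equiv.optionEquivSumPUnit.{0} H).symm).toBlocks₁₂ = 0 := by
    ext x y
    simp [Matrix.toBlocks₁₂, rootLap]
  rw [h12, Matrix.det_fromBlocks_zero₁₂]
  have h22 : (((rootLap w none).submatrix (Equiv.optionEquivSumPUnit.{0} H).symm
      (Equiv.optionEquivSumPUnit.{0} H).symm).toBlocks₂₂).det = 1 := by
    rw [Matrix.det_unique]
    simp [Matrix.toBlocks₂₂, rootLap]
  rw [h22, mul_one]
  congr 1
  ext x y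
  by_cases hxy : x = y
  · subst hxy
    simp [Matrix.toBlocks₁₁, rootLap, lap, Fintype.sum_option]
    ring
  · simp [Matrix.toBlocks₁₁, rootLap, lap, hxy]

end Laplacian

section Fourier

variable {N : ℕ} [NeZero N]

/-- A block-circulant matrix is block-diagonalised by the discrete Fourier transform. -/
theorem det_blockCirculant {H : Type*} [Fintype H] [DecidableEq H]
    (C : ZMod N → Matrix H H ℂ) :
    (Matrix.of fun p q : H × ZMod N => C (q.2 - p.2) p.1 q.1).det =
      ∏ k : ZMod N, (∑ l : ZMod N, ZMod.stdAddChar (l * k) • C l).det := by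
  classical
  set M : Matrix (H × ZMod N) (H × ZMod N) ℂ :=
    Matrix.of fun p q : H × ZMod N => C (q.2 - p.2) p.1 q.1
  set F : Matrix (ZMod N) (ZMod N) ℂ := Matrix.of fun i j => ZMod.stdAddChar (i * j) with hF
  have hFdet : F.det ≠ 0 := by
    have hmul : F * (Matrix.of fun i j => ZMod.stdAddChar (-(i * j))) =
        (N : ℂ) • (1 : Matrix (ZMod N) (ZMod N) ℂ) := by
      ext i j
      have h := AddChar.sum_mulShift (i - j) (ZMod.isPrimitive_stdAddChar N)
      simp only [Matrix.mul_apply, hF, Matrix.of_apply, Matrix.smul_apply, Matrix.one_apply,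
        smul_eq_mul, ← AddChar.map_add_eq_mul]
      rw [show ∑ k : ZMod N, ZMod.stdAddChar (i * k + -(k * j)) =
        ∑ k : ZMod N, ZMod.stdAddChar (k * (i - j)) from
        Finset.sum_congr rfl fun k _ => by ring_nf, h]
      simp [sub_eq_zero, ZMod.card]
    have := congrArg Matrix.det hmul
    rw [Matrix.det_mul, Matrix.det_smul, Matrix.det_one, mul_one] at this
    intro h0
    rw [h0, zero_mul] at this
    exact pow_ne_zero _ (Nat.cast_ne_zero.2 (NeZero.ne N)) this.symm
  set U : Matrix (H × ZMod N) (H × ZMod N) ℂ :=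
    Matrix.kroneckerMap (fun a b => a * b) (1 : Matrix H H ℂ) F with hU
  have hUdet : U.det ≠ 0 := by
    rw [hU, Matrix.det_kronecker, Matrix.det_one, one_pow, one_mul]
    exact pow_ne_zero _ hFdet
  have hMU : M * U = U * Matrix.blockDiagonal
      fun k : ZMod N => ∑ l : ZMod N, ZMod.stdAddChar (l * k) • C l := by
    ext ⟨x, i⟩ ⟨y, k⟩
    have hl : (M * U) (x, i) (y, k) = ∑ j : ZMod N, C (j - i) x y * ZMod.stdAddChar (j * k) := by
      simp only [Matrix.mul_apply, Fintype.sum_prod_type, hU, Matrix.kroneckerMap_apply,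
        Matrix.one_apply, M, Matrix.of_apply, hF]
      rw [Finset.sum_eq_single y]
      · simp
      · intro z _ hz
        simp [hz]
      · simp
    have hr : (U * Matrix.blockDiagonal
        fun k : ZMod N => ∑ l : ZMod N, ZMod.stdAddChar (l * k) • C l) (x, i) (y, k) =
        ZMod.stdAddChar (i * k) * ∑ l : ZMod N, ZMod.stdAddChar (l * k) * C l x y := by
      simp only [Matrix.mul_apply, Fintype.sum_prod_type, hU, Matrix.kroneckerMap_apply,
        Matrix.one_apply, Matrix.of_apply, hF, Matrix.blockDiagonal_apply]
      rw [Finset.sum_eq_single x]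
      · simp [Matrix.sum_apply]
      · intro z _ hz
        simp [Ne.symm hz]
      · simp
    rw [hl, hr, Finset.mul_sum, ← Equiv.sum_comp (Equiv.addRight i)]
    refine Finset.sum_congr rfl fun l _ => ?_
    simp only [Equiv.coe_addRight, add_sub_cancel_right, add_mul, AddChar.map_add_eq_mul]
    ring
  have := congrArg Matrix.det hMU
  rw [Matrix.det_mul, Matrix.det_mul, mul_comm, Matrix.det_blockDiagonal] at this
  exact mul_left_cancel₀ hUdet this

end Fourier

section Sums

theorem sum_range_eq_add_sum_Icc {M : Type*} [AddCommMonoid M] {N : ℕ} (hN : 1 ≤ N)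
    (g : ℕ → M) : ∑ i ∈ range N, g i = g 0 + ∑ i ∈ Icc 1 (N - 1), g i := by
  rw [Finset.range_eq_Ico, Finset.sum_eq_sum_Ico_succ_bot (by omega)]
  congr 1

/-- A sum over `0 < i < N`, folded along `i ↦ N - i`. -/
theorem sum_Icc_half {M : Type*} [AddCommMonoid M] {N : ℕ} (hN : 2 ≤ N) (g : ℕ → M) :
    ∑ i ∈ Icc 1 (N / 2), (if 2 * i ≠ N then g i + g (N - i) else g i) =
      ∑ i ∈ Icc 1 (N - 1), g i := by
  have h1 : ∀ i, (if 2 * i ≠ N then g i + g (N - i) else g i) =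
      g i + if 2 * i ≠ N then g (N - i) else 0 := by
    intro i
    split_ifs <;> simp
  simp only [h1, Finset.sum_add_distrib]
  rw [← Finset.sum_filter, ← Finset.sum_filter_add_sum_filter_not (Icc 1 (N - 1))
    (fun i => 2 * i ≤ N)]
  congr 1
  · refine Finset.sum_congr ?_ fun _ _ => rfl
    ext i
    simp only [Finset.mem_Icc, Finset.mem_filter]
    omega
  · refine Finset.sum_nbij' (fun i => N - i) (fun i => N - i) ?_ ?_ ?_ ?_ ?_
    · intro i
      simp only [Finset.mem_Icc, Finset.mem_filter]
      omega
    · intro i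
      simp only [Finset.mem_Icc, Finset.mem_filter]
      omega
    · intro i
      simp only [Finset.mem_Icc, Finset.mem_filter]
      omega
    · intro i
      simp only [Finset.mem_Icc, Finset.mem_filter]
      omega
    · intro i _
      rfl

@[to_additive]
theorem ZMod.prod_val_eq_prod_range {M : Type*} [CommMonoid M] {N : ℕ} [NeZero N] (g : ℕ → M) :
    ∏ k : ZMod N, g k.val = ∏ i ∈ range N, g i := by
  refine Finset.prod_nbij ZMod.val ?_ ?_ ?_ fun _ _ => rfl
  · intro k _
    exact Finset.mem_range.2 (ZMod.val_lt k)
  · exact fun _ _ _ _ h => ZMod.val_injective N h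
  · intro i hi
    exact ⟨i, by simp, ZMod.val_cast_of_lt (by simpa using hi)⟩

theorem ZMod.prod_eq_mul_prod_Icc {M : Type*} [CommMonoid M] {N : ℕ} [NeZero N]
    (g : ZMod N → M) : ∏ k, g k = g 0 * ∏ t ∈ Icc 1 (N - 1), g (t : ℕ) := by
  have h := ZMod.prod_val_eq_prod_range (N := N) fun i => g (i : ℕ)
  simp only [ZMod.natCast_zmod_val] at h
  have hN := NeZero.pos N
  rw [h, Finset.range_eq_Ico, Finset.prod_eq_prod_Ico_succ_bot hN, Nat.cast_zero]
  congr 1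

theorem sum_sum_ite_sym2 {α M : Type*} [Fintype α] [DecidableEq α] [AddCommMonoid M] {x y : α}
    (hxy : x ≠ y) (F : α → α → M) :
    ∑ a, ∑ b, (if s(a, b) = s(x, y) then F a b else 0) = F x y + F y x := by
  have h : ∀ a b, (if s(a, b) = s(x, y) then F a b else 0) =
      (if a = x then if b = y then F a b else 0 else 0) +
        if a = y then if b = x then F a b else 0 else 0 := by
    intro a b
    simp only [Sym2.eq_iff]
    by_cases h1 : a = x
    · subst h1
      simp [hxy]
    · simp [h1, ite_and]
  rw [Finset.sum_congr rfl fun a _ => Finset.sum_congr rfl fun b _ => h a b]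
  simp [Finset.sum_add_distrib, Finset.sum_ite_irrel]

end Sums

namespace WeightedGraph

variable {V R : Type*} [AddCommMonoid R]

open Classical in
/-- The total weight that a family of weighted edges puts on the pair `e`. -/
noncomputable def edgeWeight (e : Sym2 V) : Multiset (Sym2 V × R) →+ R where
  toFun E := (E.map fun p => if p.1 = e then p.2 else 0).sum
  map_zero' := by simp
  map_add' := by simp

open Classical in
theorem edgeWeight_apply (e : Sym2 V) (E : Multiset (Sym2 V × R)) :
    edgeWeight e E = (E.map fun p => if p.1 = e then p.2 else 0).sum := rfl

open Classical in
theorem edgeWeight_singleton (e e' : Sym2 V) (w : R) :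
    edgeWeight e {(e', w)} = if e' = e then w else 0 := by
  simp [edgeWeight_apply]

theorem ofEdges_weight (E : Multiset (Sym2 V × R)) {e : Sym2 V} (he : ¬ e.IsDiag) :
    (ofEdges E).weight e = edgeWeight e E := by
  classical
  simp only [ofEdges, if_neg he]
  induction E using Multiset.induction with
  | empty => simp
  | cons p E ih =>
    rw [← Multiset.singleton_add, map_add, ← ih, Multiset.filter_add, Multiset.map_add,
      Multiset.sum_add]
    congr 1
    rw [Multiset.filter_singleton, edgeWeight_singleton]
    split_ifs <;> simp

theorem edgeWeight_edgeList [Fintype V] (G : WeightedGraph V R) (e : Sym2 V) :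
    edgeWeight e G.edgeList = G.weight e := by
  classical
  have h : edgeWeight e G.edgeList =
      ∑ e' ∈ G.graph.edgeFinset, if e' = e then G.weight e' else 0 := by
    simp only [edgeWeight_apply, edgeList, Multiset.map_map, Function.comp_def]
    rw [Finset.sum]
  rw [h, Finset.sum_ite_eq']
  split_ifs with he
  · rfl
  · exact (G.weight_eq_zero e fun h' => he (SimpleGraph.mem_edgeFinset.2 h')).symm

end WeightedGraph

namespace WeightedDigraph

variable {V R : Type*} [AddCommMonoid R]

open Classical in
/-- The total weight that a family of weighted arcs puts on the pair `(a, b)`. -/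
noncomputable def arcWeight (a b : V) : Multiset (V × V × R) →+ R where
  toFun A := (A.map fun p => if p.1 = a ∧ p.2.1 = b then p.2.2 else 0).sum
  map_zero' := by simp
  map_add' := by simp

open Classical in
theorem arcWeight_apply (a b : V) (A : Multiset (V × V × R)) :
    arcWeight a b A = (A.map fun p => if p.1 = a ∧ p.2.1 = b then p.2.2 else 0).sum := rfl

open Classical in
theorem arcWeight_singleton (a b a' b' : V) (w : R) :
    arcWeight a b {(a', b', w)} = if a' = a ∧ b' = b then w else 0 := by
  simp [arcWeight_apply]

open Classical in
theorem arcWeight_cons (a b a' b' : V) (w : R) (A : Multiset (V × V × R)) :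
    arcWeight a b ((a', b', w) ::ₘ A) =
      (if a' = a ∧ b' = b then w else 0) + arcWeight a b A := by
  simp [arcWeight_apply]

theorem ofArcs_weight (A : Multiset (V × V × R)) (a b : V) :
    (ofArcs A).weight a b = arcWeight a b A := by
  classical
  simp only [ofArcs]
  induction A using Multiset.induction with
  | empty => simp
  | cons p A ih =>
    rw [← Multiset.singleton_add, map_add, ← ih, Multiset.filter_add, Multiset.map_add,
      Multiset.sum_add]
    congr 1
    rw [Multiset.filter_singleton, arcWeight_singleton]
    split_ifs <;> simp

end WeightedDigraph

theorem WeightedGraph.weight_eq_zero_of_not_adj {V R : Type*} [Zero R] (G : WeightedGraph V R)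
    {u v : V} (h : ¬ G.graph.Adj u v) : G.weight s(u, v) = 0 :=
  G.weight_eq_zero _ (by simpa using h)

theorem WeightedGraph.IsAut.weight_pow {V R : Type*} [Zero R] {G : WeightedGraph V R}
    {σ : Equiv.Perm V} (h : G.IsAut σ) (k : ℕ) (u v : V) :
    G.weight s((σ ^ k) u, (σ ^ k) v) = G.weight s(u, v) := by
  induction k with
  | zero => rfl
  | succ k ih => rw [pow_succ', Equiv.Perm.mul_apply, Equiv.Perm.mul_apply, h.2, ih]

namespace OnePeriodic

variable {V : Type*} {G : WeightedGraph V ℝ} {N : ℕ} {σ : Equiv.Perm V} {H₀ : Finset V}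

theorem theta_pow_self (hN : N ≠ 0) : theta N ^ N = 1 := by
  rw [theta, ← Complex.exp_nat_mul, mul_div_cancel₀ _ (Nat.cast_ne_zero.2 hN),
    Complex.exp_two_pi_mul_I]

theorem theta_pow_sub (hN : N ≠ 0) {i : ℕ} (hi : i ≤ N) (t : ℕ) :
    theta N ^ ((N - i) * t) = (theta N ^ (i * t))⁻¹ := by
  refine eq_inv_of_mul_eq_one_left ?_
  rw [← pow_add, ← add_mul, Nat.sub_add_cancel hi, pow_mul, theta_pow_self hN, one_pow]

theorem crossWeight_sub (hG : IsPeriodic G N σ) {i : ℕ} (hi : i ≤ N) (x y : H₀) :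
    crossWeight G σ H₀ (N - i) x y = crossWeight G σ H₀ i y x := by
  rw [crossWeight, crossWeight, ← hG.isAut.weight_pow i, ← Equiv.Perm.mul_apply, ← pow_add,
    Nat.add_sub_cancel' hi, ← hG.order, pow_orderOf_eq_one, Sym2.eq_swap, Equiv.Perm.one_apply]

theorem crossWeight_eq_zero {i : ℕ} {x y : H₀} (h : ¬ G.graph.Adj (x : V) ((σ ^ i) (y : V))) :
    crossWeight G σ H₀ i x y = 0 :=
  G.weight_eq_zero_of_not_adj h

/-- The edge weights of `H₀'` are the sums of the weights of `G` between two orbits. -/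
theorem H₀'_weight (hN : 2 ≤ N) (hG : IsPeriodic G N σ) {x y : H₀} (hxy : x ≠ y) :
    (H₀' G N σ H₀).weight s(x, y) = ∑ i ∈ range N, crossWeight G σ H₀ i x y := by
  classical
  rw [sum_range_eq_add_sum_Icc (by omega), ← sum_Icc_half hN, H₀',
    WeightedGraph.ofEdges_weight _ (by simpa using hxy), map_add,
    WeightedGraph.edgeWeight_edgeList]
  congr 1
  rw [addedEdges, map_sum]
  refine Finset.sum_congr rfl fun i hi => ?_
  have hiN : i ≤ N := by
    have := (Finset.mem_Icc.1 hi).2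
    omega
  set F : H₀ → H₀ → ℝ := fun a b =>
    if 2 * i ≠ N then crossWeight G σ H₀ i a b else crossWeight G σ H₀ i a b / 2 with hF
  have hterm : ∀ a b : H₀, WeightedGraph.edgeWeight s(x, y)
      (if a ≠ b ∧ G.graph.Adj (a : V) ((σ ^ i) (b : V)) then
        if 2 * i ≠ N then {(s(a, b), crossWeight G σ H₀ i a b)}
        else {(s(a, b), crossWeight G σ H₀ i a b / 2)}
      else 0) = if s(a, b) = s(x, y) then F a b else 0 := by
    intro a b
    by_cases hab : a = b
    · subst hab
      have : ¬ s(a, a) = s(x, y) := by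
        intro h
        exact hxy (by simpa using congrArg Sym2.IsDiag h)
      simp [this]
    · by_cases hadj : G.graph.Adj (a : V) ((σ ^ i) (b : V))
      · rw [if_pos ⟨hab, hadj⟩]
        by_cases h2 : 2 * i ≠ N
        · simp only [hF, if_pos h2, WeightedGraph.edgeWeight_singleton]
          congr
        · simp only [hF, if_neg h2, WeightedGraph.edgeWeight_singleton]
          congr
      · simp [hadj, hF, crossWeight_eq_zero hadj]
  simp only [map_sum]
  rw [Finset.sum_congr rfl fun a _ => Finset.sum_congr rfl fun b _ => hterm a b,
    sum_sum_ite_sym2 hxy, crossWeight_sub hG hiN]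
  simp only [hF]
  split_ifs with h2
  · rfl
  · have h2 : N - i = i := by omega
    rw [← crossWeight_sub hG hiN, h2]
    ring

open WeightedDigraph

theorem arcWeight_arcs₁_some (x y : H₀) :
    arcWeight (some x) (some y) (arcs₁ G H₀) = (crossWeight G σ H₀ 0 x y : ℂ) := by
  classical
  have hterm : ∀ a b : H₀, arcWeight (some x) (some y)
      (if (G.induce H₀).graph.Adj a b then
        {(some a, some b, ((G.induce H₀).weight s(a, b) : ℂ))} else 0) =
      if a = x then if b = y then (crossWeight G σ H₀ 0 a b : ℂ) else 0 else 0 := by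
    intro a b
    have hw : (G.induce H₀).weight s(a, b) = crossWeight G σ H₀ 0 a b := rfl
    rw [hw]
    by_cases hadj : (G.induce H₀).graph.Adj a b
    · rw [if_pos hadj, arcWeight_singleton]
      simp [ite_and]
    · have : crossWeight G σ H₀ 0 a b = 0 := crossWeight_eq_zero hadj
      simp [hadj, this]
  simp only [arcs₁, map_sum]
  rw [Finset.sum_congr rfl fun a _ => Finset.sum_congr rfl fun b _ => hterm a b]
  simp [Finset.sum_ite_irrel]

theorem arcWeight_arcs₁_none (x : H₀) : arcWeight (some x) none (arcs₁ G H₀) = 0 := by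
  classical
  simp only [arcs₁, map_sum]
  refine Finset.sum_eq_zero fun a _ => Finset.sum_eq_zero fun b _ => ?_
  split_ifs <;> simp [arcWeight_singleton]

theorem arcWeight_arcs₃_some {t : ℕ} {x y : H₀} (hxy : x ≠ y) :
    arcWeight (some x) (some y) (arcs₃ G N σ H₀ t) = ∑ i ∈ Icc 1 (N / 2),
      if 2 * i ≠ N then theta N ^ (i * t) * (crossWeight G σ H₀ i x y : ℂ) +
        (theta N ^ (i * t))⁻¹ * (crossWeight G σ H₀ i y x : ℂ)
      else theta N ^ (i * t) * (crossWeight G σ H₀ i x y : ℂ) := by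
  classical
  simp only [arcs₃, map_sum]
  refine Finset.sum_congr rfl fun i _ => ?_
  by_cases h2 : 2 * i ≠ N
  · simp only [if_pos h2]
    have hterm : ∀ a b : H₀, arcWeight (some x) (some y)
        (if a ≠ b ∧ G.graph.Adj (a : V) ((σ ^ i) (b : V)) then
          {(some a, none, (1 - theta N ^ (i * t)) * (crossWeight G σ H₀ i a b : ℂ)),
          (some b, none, (1 - (theta N ^ (i * t))⁻¹) * (crossWeight G σ H₀ i a b : ℂ)),
          (some a, some b, theta N ^ (i * t) * (crossWeight G σ H₀ i a b : ℂ)),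
          (some b, some a, (theta N ^ (i * t))⁻¹ * (crossWeight G σ H₀ i a b : ℂ))}
        else 0) =
        (if a = x then if b = y then
          theta N ^ (i * t) * (crossWeight G σ H₀ i a b : ℂ) else 0 else 0) +
        if a = y then if b = x then
          (theta N ^ (i * t))⁻¹ * (crossWeight G σ H₀ i a b : ℂ) else 0 else 0 := by
      intro a b
      by_cases hab : a = b
      · subst hab
        by_cases hax : a = x
        · subst hax
          simp [hxy]
        · simp [hax]
      · by_cases hadj : G.graph.Adj (a : V) ((σ ^ i) (b : V))
        · rw [if_pos ⟨hab, hadj⟩]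
          simp only [Multiset.insert_eq_cons, arcWeight_cons, arcWeight_singleton]
          simp [ite_and, and_comm (a := b = x)]
        · simp [hadj, crossWeight_eq_zero hadj]
    rw [Finset.sum_congr rfl fun a _ => Finset.sum_congr rfl fun b _ => hterm a b]
    simp [Finset.sum_add_distrib, Finset.sum_ite_irrel]
  · simp only [if_neg h2]
    have hterm : ∀ a b : H₀, arcWeight (some x) (some y)
        (if a ≠ b ∧ G.graph.Adj (a : V) ((σ ^ i) (b : V)) then
          {(some a, none, (1 - theta N ^ (i * t)) * (crossWeight G σ H₀ i a b : ℂ)),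
          (some a, some b, theta N ^ (i * t) * (crossWeight G σ H₀ i a b : ℂ))}
        else 0) =
        if a = x then if b = y then
          theta N ^ (i * t) * (crossWeight G σ H₀ i a b : ℂ) else 0 else 0 := by
      intro a b
      by_cases hab : a = b
      · subst hab
        by_cases hax : a = x
        · subst hax
          simp [hxy]
        · simp [hax]
      · by_cases hadj : G.graph.Adj (a : V) ((σ ^ i) (b : V))
        · rw [if_pos ⟨hab, hadj⟩]
          simp only [Multiset.insert_eq_cons, arcWeight_cons, arcWeight_singleton]
          simp [ite_and]
        · simp [hadj, crossWeight_eq_zero hadj]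
    rw [Finset.sum_congr rfl fun a _ => Finset.sum_congr rfl fun b _ => hterm a b]
    simp [Finset.sum_ite_irrel]

theorem arcWeight_arcs₃_none [DecidableEq V] {t : ℕ} (x : H₀) :
    arcWeight (some x) none (arcs₃ G N σ H₀ t) = ∑ i ∈ Icc 1 (N / 2), ∑ b : H₀,
      if b = x then 0 else
        if 2 * i ≠ N then (1 - theta N ^ (i * t)) * (crossWeight G σ H₀ i x b : ℂ) +
          (1 - (theta N ^ (i * t))⁻¹) * (crossWeight G σ H₀ i b x : ℂ)
        else (1 - theta N ^ (i * t)) * (crossWeight G σ H₀ i x b : ℂ) := by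
  classical
  simp only [arcs₃, map_sum]
  refine Finset.sum_congr rfl fun i _ => ?_
  by_cases h2 : 2 * i ≠ N
  · simp only [if_pos h2]
    have hterm : ∀ a b : H₀, arcWeight (some x) none
        (if a ≠ b ∧ G.graph.Adj (a : V) ((σ ^ i) (b : V)) then
          {(some a, none, (1 - theta N ^ (i * t)) * (crossWeight G σ H₀ i a b : ℂ)),
          (some b, none, (1 - (theta N ^ (i * t))⁻¹) * (crossWeight G σ H₀ i a b : ℂ)),
          (some a, some b, theta N ^ (i * t) * (crossWeight G σ H₀ i a b : ℂ)),
          (some b, some a, (theta N ^ (i * t))⁻¹ * (crossWeight G σ H₀ i a b : ℂ))}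
        else 0) =
        (if a = x then if b = x then 0 else
          (1 - theta N ^ (i * t)) * (crossWeight G σ H₀ i a b : ℂ) else 0) +
        if b = x then if a = x then 0 else
          (1 - (theta N ^ (i * t))⁻¹) * (crossWeight G σ H₀ i a b : ℂ) else 0 := by
      intro a b
      by_cases hab : a = b
      · subst hab
        by_cases hax : a = x <;> simp [hax]
      · by_cases hadj : G.graph.Adj (a : V) ((σ ^ i) (b : V))
        · rw [if_pos ⟨hab, hadj⟩]
          simp only [Multiset.insert_eq_cons, arcWeight_cons, arcWeight_singleton]
          by_cases hax : a = x
          · subst hax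
            simp [Ne.symm hab]
          · simp [hax]
        · simp [hadj, crossWeight_eq_zero hadj]
    rw [Finset.sum_congr rfl fun a _ => Finset.sum_congr rfl fun b _ => hterm a b]
    simp only [Finset.sum_add_distrib]
    rw [Finset.sum_comm (f := fun a b : H₀ => if b = x then if a = x then 0 else
          (1 - (theta N ^ (i * t))⁻¹) * (crossWeight G σ H₀ i a b : ℂ) else 0)]
    simp only [Finset.sum_ite_irrel, Finset.sum_const_zero, Finset.sum_ite_eq', Finset.mem_univ,
      if_true, ← Finset.sum_add_distrib]
    refine Finset.sum_congr rfl fun b _ => ?_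
    split_ifs <;> simp
  · simp only [if_neg h2]
    have hterm : ∀ a b : H₀, arcWeight (some x) none
        (if a ≠ b ∧ G.graph.Adj (a : V) ((σ ^ i) (b : V)) then
          {(some a, none, (1 - theta N ^ (i * t)) * (crossWeight G σ H₀ i a b : ℂ)),
          (some a, some b, theta N ^ (i * t) * (crossWeight G σ H₀ i a b : ℂ))}
        else 0) =
        if a = x then if b = x then 0 else
          (1 - theta N ^ (i * t)) * (crossWeight G σ H₀ i a b : ℂ) else 0 := by
      intro a b
      by_cases hab : a = b
      · subst hab
        by_cases hax : a = x <;> simp [hax]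
      · by_cases hadj : G.graph.Adj (a : V) ((σ ^ i) (b : V))
        · rw [if_pos ⟨hab, hadj⟩]
          simp only [Multiset.insert_eq_cons, arcWeight_cons, arcWeight_singleton]
          by_cases hax : a = x
          · subst hax
            simp [Ne.symm hab]
          · simp [hax]
        · simp [hadj, crossWeight_eq_zero hadj]
    rw [Finset.sum_congr rfl fun a _ => Finset.sum_congr rfl fun b _ => hterm a b]
    simp only [Finset.sum_ite_irrel, Finset.sum_const_zero, Finset.sum_ite_eq', Finset.mem_univ,
      if_true]

theorem arcWeight_arcs₄_some {t : ℕ} (x y : H₀) :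
    arcWeight (some x) (some y) (arcs₄ G N σ H₀ t) = 0 := by
  classical
  simp only [arcs₄, map_sum]
  refine Finset.sum_eq_zero fun i _ => Finset.sum_eq_zero fun a _ => ?_
  split_ifs <;> simp [arcWeight_singleton]

theorem arcWeight_arcs₄_none {t : ℕ} (x : H₀) :
    arcWeight (some x) none (arcs₄ G N σ H₀ t) = ∑ i ∈ Icc 1 (N / 2),
      if 2 * i ≠ N then
        (2 - theta N ^ (i * t) - (theta N ^ (i * t))⁻¹) * (crossWeight G σ H₀ i x x : ℂ)
      else (1 - theta N ^ (i * t)) * (crossWeight G σ H₀ i x x : ℂ) := by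
  classical
  simp only [arcs₄, map_sum]
  refine Finset.sum_congr rfl fun i _ => ?_
  rw [Finset.sum_eq_single x]
  · by_cases hadj : G.graph.Adj (x : V) ((σ ^ i) (x : V))
    · rw [if_pos hadj]
      split_ifs <;> simp [arcWeight_singleton]
    · simp [hadj, crossWeight_eq_zero hadj]
  · intro a _ ha
    split_ifs <;> simp [arcWeight_singleton, ha]
  · simp

/-- The arc weights of `Dₜ'` between vertices of `H₀`. -/
theorem D'_weight_some (hN : 2 ≤ N) (hG : IsPeriodic G N σ) (t : ℕ) {x y : H₀} (hxy : x ≠ y) :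
    (D' G N σ H₀ t).weight (some x) (some y) =
      ∑ i ∈ range N, theta N ^ (i * t) * (crossWeight G σ H₀ i x y : ℂ) := by
  rw [sum_range_eq_add_sum_Icc (by omega), ← sum_Icc_half hN, D', ofArcs_weight, map_add, map_add,
    arcWeight_arcs₁_some (σ := σ), arcWeight_arcs₃_some hxy, arcWeight_arcs₄_some, add_zero,
    zero_mul, pow_zero, one_mul]
  congr 1
  refine Finset.sum_congr rfl fun i hi => ?_
  have hiN : i ≤ N := by
    have := (Finset.mem_Icc.1 hi).2
    omega
  rw [crossWeight_sub hG hiN, theta_pow_sub (by omega) hiN]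

/-- The weights of the arcs of `Dₜ'` to the root. -/
theorem D'_weight_none (hN : 2 ≤ N) (hG : IsPeriodic G N σ) (t : ℕ) (x : H₀) :
    (D' G N σ H₀ t).weight (some x) none =
      ∑ y : H₀, ∑ i ∈ range N, (1 - theta N ^ (i * t)) * (crossWeight G σ H₀ i x y : ℂ) := by
  classical
  have h0 : ∀ y : H₀,
      ∑ i ∈ range N, (1 - theta N ^ (i * t)) * (crossWeight G σ H₀ i x y : ℂ) =
      ∑ i ∈ Icc 1 (N / 2),
        if 2 * i ≠ N then (1 - theta N ^ (i * t)) * (crossWeight G σ H₀ i x y : ℂ) +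
          (1 - (theta N ^ (i * t))⁻¹) * (crossWeight G σ H₀ i y x : ℂ)
        else (1 - theta N ^ (i * t)) * (crossWeight G σ H₀ i x y : ℂ) := by
    intro y
    rw [sum_range_eq_add_sum_Icc (by omega), ← sum_Icc_half hN, zero_mul, pow_zero, sub_self,
      zero_mul, zero_add]
    refine Finset.sum_congr rfl fun i hi => ?_
    have hiN : i ≤ N := by
      have := (Finset.mem_Icc.1 hi).2
      omega
    rw [crossWeight_sub hG hiN, theta_pow_sub (by omega) hiN]
  rw [Finset.sum_congr rfl fun y _ => h0 y, Finset.sum_comm, D', ofArcs_weight, map_add, map_add,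
    arcWeight_arcs₁_none, arcWeight_arcs₃_none, arcWeight_arcs₄_none, zero_add,
    ← Finset.sum_add_distrib]
  refine Finset.sum_congr rfl fun i _ => ?_
  rw [← Finset.add_sum_erase univ _ (Finset.mem_univ x), if_pos rfl, zero_add,
    ← Finset.add_sum_erase univ (fun y => if 2 * i ≠ N then _ else _) (Finset.mem_univ x), add_comm]
  congr 1
  · split_ifs
    · ring
    · rfl
  · exact Finset.sum_congr rfl fun b hb => if_neg (Finset.ne_of_mem_erase hb)

end OnePeriodic

theorem lap_congr {V R : Type*} [Fintype V] [DecidableEq V] [CommRing R] {w w' : V → V → R}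
    (h : ∀ x y, x ≠ y → w x y = w' x y) : lap w = lap w' := by
  ext x y
  simp only [lap, Matrix.sub_apply, Matrix.of_apply, Matrix.diagonal_apply]
  by_cases hxy : x = y
  · subst hxy
    simp only [if_true]
    rw [← Finset.add_sum_erase univ _ (Finset.mem_univ x),
      ← Finset.add_sum_erase univ (w' x) (Finset.mem_univ x), add_sub_cancel_left,
      add_sub_cancel_left]
    exact Finset.sum_congr rfl fun z hz => h x z (Finset.ne_of_mem_erase hz).symm
  · simp [hxy, h x y hxy]

/-- The matrix-tree theorem for weighted graphs, over the complex numbers. -/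
theorem WeightedGraph.det_lap_add_const {V : Type*} [Fintype V] [DecidableEq V] [Nonempty V]
    (G : WeightedGraph V ℝ) (t : ℂ) :
    (lap (fun x y => (G.weight s(x, y) : ℂ)) + Matrix.of fun _ _ => t).det =
      t * (Fintype.card V : ℂ) ^ 2 * (G.tau : ℂ) := by
  obtain ⟨r⟩ := ‹Nonempty V›
  rw [_root_.det_lap_add_const (fun x y => by rw [Sym2.eq_swap]) r, det_rootLap,
    G.tau_eq_rootedSum r]
  simp [rootedSum]

namespace OnePeriodic

variable {V : Type*} {G : WeightedGraph V ℝ} {N : ℕ} {σ : Equiv.Perm V} {H₀ : Finset V}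

theorem stdAddChar_mul_natCast [NeZero N] (l : ZMod N) (t : ℕ) :
    ZMod.stdAddChar (l * (t : ZMod N)) = theta N ^ (l.val * t) := by
  have h : l * (t : ZMod N) = ((l.val * t : ℕ) : ℤ) := by
    push_cast
    rw [ZMod.natCast_zmod_val]
  rw [h, ZMod.stdAddChar_coe, theta, ← Complex.exp_nat_mul]
  congr 1
  push_cast
  ring

theorem pow_val_add [NeZero N] (hσ : orderOf σ = N) (i j : ZMod N) :
    σ ^ (i + j).val = σ ^ i.val * σ ^ j.val := by
  rw [ZMod.val_add, ← pow_add, pow_eq_pow_iff_modEq, hσ]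
  exact Nat.mod_modEq _ _

/-- The vertices of `G` are the translates `σ^i(x)` of the vertices `x` of `H₀`. -/
theorem bijective_translate [NeZero N] (hV₁ : V₁ σ = ∅) (hH₀ : IsFirstPart N σ H₀) :
    Function.Bijective fun p : H₀ × ZMod N => (σ ^ p.2.val) (p.1 : V) := by
  have hex : ∀ v, ∃! i : Fin N, ∃ x ∈ H₀, (σ ^ (i : ℕ)) x = v := fun v =>
    (hH₀ v).1 (by simp [hV₁])
  constructor
  · rintro ⟨x, i⟩ ⟨y, j⟩ h
    have h : (σ ^ i.val) (x : V) = (σ ^ j.val) (y : V) := h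
    have hij : (⟨i.val, ZMod.val_lt i⟩ : Fin N) = ⟨j.val, ZMod.val_lt j⟩ :=
      (hex ((σ ^ i.val) (x : V))).unique ⟨x, x.2, rfl⟩ ⟨y, y.2, h.symm⟩
    have hij : i = j := ZMod.val_injective N (congrArg Fin.val hij)
    subst hij
    rw [Prod.mk.injEq]
    exact ⟨Subtype.ext ((σ ^ i.val).injective h), rfl⟩
  · intro v
    obtain ⟨i, ⟨x, hx, hv⟩, -⟩ := hex v
    refine ⟨(⟨x, hx⟩, (i : ℕ)), ?_⟩
    simpa [ZMod.val_cast_of_lt i.2] using hv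

theorem weight_translate [NeZero N] (hG : IsPeriodic G N σ) (x y : H₀) (i j : ZMod N) :
    G.weight s((σ ^ i.val) (x : V), (σ ^ j.val) (y : V)) =
      crossWeight G σ H₀ (j - i).val x y := by
  have h : σ ^ j.val = σ ^ i.val * σ ^ (j - i).val := by
    rw [← pow_val_add hG.order, add_sub_cancel]
  rw [h, Equiv.Perm.mul_apply, hG.isAut.weight_pow]
  rfl

/-- The Fourier transform of the blocks of the weight matrix of `G`. -/
noncomputable def symbol (G : WeightedGraph V ℝ) (N : ℕ) [NeZero N] (σ : Equiv.Perm V)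
    (H₀ : Finset V) (k : ZMod N) (x y : H₀) : ℂ :=
  ∑ l : ZMod N, ZMod.stdAddChar (l * k) * (crossWeight G σ H₀ l.val x y : ℂ)

theorem symbol_natCast [NeZero N] (t : ℕ) (x y : H₀) :
    symbol G N σ H₀ t x y =
      ∑ i ∈ range N, theta N ^ (i * t) * (crossWeight G σ H₀ i x y : ℂ) := by
  rw [← ZMod.sum_val_eq_sum_range (N := N)
    fun i => theta N ^ (i * t) * (crossWeight G σ H₀ i x y : ℂ)]
  simp only [symbol, stdAddChar_mul_natCast]

theorem symbol_zero [NeZero N] (x y : H₀) :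
    symbol G N σ H₀ 0 x y = ∑ i ∈ range N, (crossWeight G σ H₀ i x y : ℂ) := by
  have := symbol_natCast (G := G) (N := N) (σ := σ) 0 x y
  simpa using this

open Classical in
/-- The Laplacian matrix of `G` is block-diagonalised by the Fourier transform. -/
theorem det_lap_eq_prod [Fintype V] [NeZero N] (hG : IsPeriodic G N σ) (hV₁ : V₁ σ = ∅)
    (hH₀ : IsFirstPart N σ H₀) :
    (lap (fun x y => (G.weight s(x, y) : ℂ)) + Matrix.of fun _ _ => 1).det =
      ∏ k : ZMod N, (Matrix.diagonal (fun x => ∑ y, symbol G N σ H₀ 0 x y) -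
        Matrix.of (symbol G N σ H₀ k) +
        Matrix.of fun _ _ => if k = 0 then (N : ℂ) else 0).det := by
  let e : H₀ × ZMod N ≃ V := Equiv.ofBijective _ (bijective_translate hV₁ hH₀)
  have he : ∀ p, e p = (σ ^ p.2.val) (p.1 : V) := fun p => rfl
  set C : ZMod N → Matrix H₀ H₀ ℂ := fun l => Matrix.of fun x y =>
    (if l = 0 then if x = y then ∑ z, symbol G N σ H₀ 0 x z else 0 else 0) -
      (crossWeight G σ H₀ l.val x y : ℂ) + 1 with hC
  have hdeg : ∀ p : H₀ × ZMod N,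
      ∑ v, (G.weight s(e p, v) : ℂ) = ∑ z, symbol G N σ H₀ 0 p.1 z := by
    rintro ⟨x, i⟩
    rw [← Equiv.sum_comp e, Fintype.sum_prod_type]
    refine Finset.sum_congr rfl fun y _ => ?_
    simp only [he, weight_translate hG, symbol, mul_zero, AddChar.map_zero_eq_one, one_mul]
    exact Equiv.sum_comp (Equiv.subRight i) fun l => (crossWeight G σ H₀ l.val x y : ℂ)
  rw [← Matrix.det_submatrix_equiv_self e]
  have hsub : (lap (fun x y => (G.weight s(x, y) : ℂ)) + Matrix.of fun _ _ => 1).submatrix e e =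
      Matrix.of fun p q : H₀ × ZMod N => C (q.2 - p.2) p.1 q.1 := by
    ext p q
    simp only [Matrix.submatrix_apply, Matrix.add_apply, lap, Matrix.sub_apply, Matrix.of_apply,
      Matrix.diagonal_apply, hC, hdeg, EmbeddingLike.apply_eq_iff_eq]
    rw [he, he, weight_translate hG]
    congr 2
    rw [← ite_and]
    refine if_congr ?_ rfl rfl
    rw [sub_eq_zero, Prod.ext_iff, and_comm, eq_comm (a := p.2)]
  rw [hsub, det_blockCirculant]
  refine Finset.prod_congr rfl fun k _ => ?_
  congr 1
  ext x y
  have hsum := AddChar.sum_mulShift k (ZMod.isPrimitive_stdAddChar N)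
  rw [ZMod.card] at hsum
  simp only [Matrix.sum_apply, Matrix.smul_apply, hC, Matrix.of_apply, smul_eq_mul, mul_add,
    mul_sub, mul_one, Finset.sum_add_distrib, Finset.sum_sub_distrib, hsum, Matrix.add_apply,
    Matrix.sub_apply, Matrix.diagonal_apply]
  congr 1
  · congr 1
    simp
  · split_ifs <;> simp

end OnePeriodic

theorem theorem3p8 {V : Type*} [Fintype V] (N : ℕ) (hN : 2 ≤ N) (G : WeightedGraph V ℝ)
    (σ : Equiv.Perm V) (hG : OnePeriodic.IsPeriodic G N σ) (hV₁ : OnePeriodic.V₁ σ = ∅)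
    (H₀ : Finset V) (hH₀ : OnePeriodic.IsFirstPart N σ H₀) :
    (G.tau : ℂ) =
      ((OnePeriodic.H₀' G N σ H₀).tau : ℂ) / (N : ℂ) *
        ∏ t ∈ Finset.Icc 1 (N - 1), (OnePeriodic.D' G N σ H₀ t).tau none := by
  classical
  open OnePeriodic in
  have : NeZero N := ⟨by omega⟩
  have hbij := bijective_translate hV₁ hH₀
  have hV : Nonempty V := by
    by_contra h
    rw [not_nonempty_iff] at h
    have h1 : σ = 1 := Subsingleton.elim _ _
    have := hG.order
    rw [h1, orderOf_one] at this
    omega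
  have hH : Nonempty H₀ := by
    obtain ⟨v⟩ := hV
    obtain ⟨p, -⟩ := hbij.2 v
    exact ⟨p.1⟩
  have hcard : Fintype.card V = Fintype.card H₀ * N := by
    rw [← Fintype.card_of_bijective hbij, Fintype.card_prod, ZMod.card]
  have key := det_lap_eq_prod hG hV₁ hH₀
  rw [G.det_lap_add_const, ZMod.prod_eq_mul_prod_Icc] at key
  have hzero : (Matrix.diagonal (fun x => ∑ y, symbol G N σ H₀ 0 x y) -
      Matrix.of (symbol G N σ H₀ 0) +
      Matrix.of fun _ _ => if (0 : ZMod N) = 0 then (N : ℂ) else 0).det =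
      N * (Fintype.card H₀ : ℂ) ^ 2 * ((H₀' G N σ H₀).tau : ℂ) := by
    rw [← (H₀' G N σ H₀).det_lap_add_const]
    congr 2
    · refine lap_congr (w := symbol G N σ H₀ 0) fun x y hxy => ?_
      rw [symbol_zero, H₀'_weight hN hG hxy]
      push_cast
      rfl
    · simp
  have hpos : ∀ t ∈ Icc 1 (N - 1), (Matrix.diagonal (fun x => ∑ y, symbol G N σ H₀ 0 x y) -
      Matrix.of (symbol G N σ H₀ (t : ZMod N)) +
      Matrix.of fun _ _ => if (t : ZMod N) = 0 then (N : ℂ) else 0).det =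
      (D' G N σ H₀ t).tau none := by
    intro t ht
    have ht0 : (t : ZMod N) ≠ 0 := by
      rw [Ne, ZMod.natCast_eq_zero_iff]
      have := Finset.mem_Icc.1 ht
      exact Nat.not_dvd_of_pos_of_lt (by omega) (by omega)
    rw [WeightedDigraph.tau_eq_rootedSum, ← det_rootLap, det_rootLap_none,
      lap_congr (w' := symbol G N σ H₀ (t : ZMod N)) fun x y hxy => by
        rw [D'_weight_some hN hG t hxy, symbol_natCast]]
    congr 1
    ext x y
    simp only [ht0, if_false, Matrix.add_apply, Matrix.sub_apply, Matrix.of_apply, lap,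
      Matrix.diagonal_apply, add_zero, D'_weight_none hN hG, sub_mul, one_mul,
      Finset.sum_sub_distrib, ← symbol_natCast, ← symbol_zero]
    split_ifs <;> ring
  rw [hzero, Finset.prod_congr rfl hpos, hcard] at key
  push_cast at key
  have hN0 : (N : ℂ) ≠ 0 := Nat.cast_ne_zero.2 (NeZero.ne N)
  have hm0 : (Fintype.card H₀ : ℂ) ≠ 0 := Nat.cast_ne_zero.2 Fintype.card_ne_zero
  rw [div_mul_eq_mul_div, eq_div_iff hN0]
  refine mul_left_cancel₀ (mul_ne_zero hN0 (pow_ne_zero 2 hm0)) ?_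
  linear_combination key
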